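/- Let $n\ge 1$ agents $1,\dots,n$ and a finite set $[m]=\{1,\dots,m\}$ of items be given, where each agent $i$ has an additive valuation $v_i:2^{[m]}\to\mathbb R_{\ge 0}$, i.e. $v_i(S\cup T)=v_i(S)+v_i(T)$ for all disjoint $S,T\subseteq[m]$. An allocation is a tuple $X=(X_1,\dots,X_n)$ of pairwise disjoint subsets of $[m]$; it is complete if $\bigcup_i X_i=[m]$. Its Nash welfare is $\mathrm{NW}(X)=\prod_{i=1}^n v_i(X_i)^{1/n}$. For $k\ge1$ and $S\subseteq[m]$ let $\mu_i(k,S)=\max_{(P_1,\dots,P_k)}\min_{1\le a\le k}v_i(P_a)$, the maximum being over all partitions of $S$ into $k$ pairwise disjoint, possibly empty, parts. Let $\varphi=(1+\sqrt5)/2$. Then for every real $\alpha$ with $0\le\alpha\le\varphi-1$ there exists a complete allocation $X$ that has all of the following properties simultaneously: 1. ($\alpha$-EFX) $v_i(X_i)\ge\alpha\, v_i(X_j\setminus\{g\})$ for all agents $i,j$ and every $g\in X_j$; 2. (EF1) for all agents $i,j$ with $X_j\ne\emptyset$ there is $g\in X_j$ with $v_i(X_i)\ge v_i(X_j\setminus\{g\})$;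 3. ($\frac{\alpha}{\alpha^2+1}$-GMMS) $v_i(X_i)\ge\frac{\alpha}{\alpha^2+1}\,\mu_i\bigl(|I|,\bigcup_{j\in I}X_j\bigr)$ for every set $I$ of agents and every $i\in I$; 4. ($(\varphi-1)$-PMMS) $v_i(X_i)\ge(\varphi-1)\,\mu_i(2,X_i\cup X_j)$ for every two distinct agents $i,j$; 5. ($\frac1{\alpha+1}$-MNW) $\mathrm{NW}(X)\ge\frac1{\alpha+1}\max_Y\mathrm{NW}(Y)$, the maximum being over all (complete or partial) allocations $Y$. -/

import Mathlib

/- Fair division of `m` indivisible items among `n` agents. Agents are `Fin n`, items are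
`Fin m`, and `v i S` is the value of agent `i` for the set `S` of items. -/

namespace FairDivision

/-- A valuation of sets of items is a nonnegative real-valued set function. -/
def IsValuation {m : ℕ} (v : Finset (Fin m) → ℝ) : Prop :=
  ∀ S, 0 ≤ v S

/-- Additivity of a valuation. -/
def IsAdditive {m : ℕ} (v : Finset (Fin m) → ℝ) : Prop :=
  ∀ S T, Disjoint S T → v (S ∪ T) = v S + v T

/-- An allocation (possibly partial): pairwise disjoint bundles of items. -/
def IsAllocation {n m : ℕ} (X : Fin n → Finset (Fin m)) : Prop :=
  ∀ i j, i ≠ j → Disjoint (X i) (X j)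

/-- A complete allocation: all items are allocated. -/
def IsCompleteAllocation {n m : ℕ} (X : Fin n → Finset (Fin m)) : Prop :=
  IsAllocation X ∧ Finset.univ.biUnion X = Finset.univ

/-- `α`-EFX. -/
def IsEFX {n m : ℕ} (v : Fin n → Finset (Fin m) → ℝ) (α : ℝ)
    (X : Fin n → Finset (Fin m)) : Prop :=
  ∀ i j, ∀ g ∈ X j, α * v i (X j \ {g}) ≤ v i (X i)

/-- EF1 (an empty bundle is not envied). -/
def IsEF1 {n m : ℕ} (v : Fin n → Finset (Fin m) → ℝ) (X : Fin n → Finset (Fin m)) : Prop :=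
  ∀ i j, X j = ∅ ∨ ∃ g ∈ X j, v i (X j \ {g}) ≤ v i (X i)

/-- Partitions of the set `S` of items into `k` labelled parts, which may be empty. -/
def IsPartition {m k : ℕ} (S : Finset (Fin m)) (P : Fin k → Finset (Fin m)) : Prop :=
  (∀ a b, a ≠ b → Disjoint (P a) (P b)) ∧ Finset.univ.biUnion P = S

/-- The maximin share `μ(k, S)`: the maximum over all partitions `P` of `S` into `k` parts of the
minimum value of a part. For `1 ≤ k` both the supremum and the infimum range over finite nonempty
sets, so they are a maximum and a minimum. -/
noncomputable def maximinShare {m : ℕ} (v : Finset (Fin m) → ℝ) (k : ℕ) (S : Finset (Fin m)) : ℝ :=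
  ⨆ P : {P : Fin k → Finset (Fin m) // IsPartition S P}, ⨅ a : Fin k, v (P.1 a)

/-- `α`-PMMS (pairwise maximin share). -/
def IsPMMS {n m : ℕ} (v : Fin n → Finset (Fin m) → ℝ) (α : ℝ)
    (X : Fin n → Finset (Fin m)) : Prop :=
  ∀ i j, i ≠ j → α * maximinShare (v i) 2 (X i ∪ X j) ≤ v i (X i)

/-- `α`-GMMS (groupwise maximin share). -/
def IsGMMS {n m : ℕ} (v : Fin n → Finset (Fin m) → ℝ) (α : ℝ)
    (X : Fin n → Finset (Fin m)) : Prop :=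
  ∀ I : Finset (Fin n), ∀ i ∈ I, α * maximinShare (v i) I.card (I.biUnion X) ≤ v i (X i)

/-- The Nash welfare: the geometric mean of the agents' values. -/
noncomputable def nashWelfare {n m : ℕ} (v : Fin n → Finset (Fin m) → ℝ)
    (X : Fin n → Finset (Fin m)) : ℝ :=
  ∏ i, v i (X i) ^ (1 / (n : ℝ))

/-- A maximum Nash welfare allocation. -/
def IsMaxNashWelfare {n m : ℕ} (v : Fin n → Finset (Fin m) → ℝ)
    (X : Fin n → Finset (Fin m)) : Prop :=
  IsAllocation X ∧ ∀ Y, IsAllocation Y → nashWelfare v Y ≤ nashWelfare v X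

/-- `β`-MNW: at least a `β` fraction of the maximum Nash welfare. (A maximum Nash welfare
allocation exists, and all of them have the same Nash welfare.) -/
def IsMNW {n m : ℕ} (v : Fin n → Finset (Fin m) → ℝ) (β : ℝ)
    (Z : Fin n → Finset (Fin m)) : Prop :=
  ∃ X, IsMaxNashWelfare v X ∧ β * nashWelfare v X ≤ nashWelfare v Z

end FairDivision

set_option linter.unusedSectionVars false

open Finset

/-! Rescale a complete allocation of maximum Nash welfare so that every agent values her bundle at
one. Discard an item from a bundle whenever somebody envies what would remain; the envy of an agent
who still has her whole bundle counts only if it exceeds the factor 1/α. For a minimal set D of kept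
items, agents who lost something are EFX-satisfied and all others α-EFX-satisfied
(`exists_good_kept`).

Every reduced bundle has a chaser, so kept bundles can be shifted along a chain of chasers up to an
agent with a whole bundle, who gains more than 1/α while only the agent at the start loses
(`exists_augmentation`). As the product of the values cannot exceed one, each agent has kept at
least 1/(1+α), which yields the welfare bound, and a discarded item is worth to any agent at most α
times her kept value (`le_mul_weight_kept`). Envy cycle elimination (`exists_complete`) then hands
out the discarded items while preserving `Good`.

The clauses of `Good` are what the four fairness notions need: `group` gives GMMS by averaging
(`exists_part_le`), and `pair` gives PMMS (`exists_half_le`). Zero values are reached from positive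
ones by a limit (`exists_solution`). -/

namespace FairDivision

/-! ### Weights, comparisons with a bundle, envy cycle elimination -/

section Core

variable {ι κ : Type*} [Fintype ι] [DecidableEq ι] [Fintype κ] [DecidableEq κ]

/-- The total weight of a set of items. -/
def weight (b : κ → ℝ) (S : Finset κ) : ℝ := ∑ g ∈ S, b g

/-- The items that the complete allocation `o` gives to agent `i`. -/
def owned (o : κ → ι) (i : ι) : Finset κ := univ.filter fun g => o g = i

/-- The items that the partial allocation `h` gives to agent `i`. -/
def bundle (h : κ → Option ι) (i : ι) : Finset κ := univ.filter fun g => h g = some i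

/-- The items of agent `i` among those in `D`. -/
def kept (o : κ → ι) (D : Finset κ) (i : ι) : Finset κ := D.filter fun g => o g = i

@[simp] lemma mem_owned {o : κ → ι} {i : ι} {g : κ} : g ∈ owned o i ↔ o g = i := by
  simp [owned]

@[simp] lemma mem_bundle {h : κ → Option ι} {i : ι} {g : κ} :
    g ∈ bundle h i ↔ h g = some i := by
  simp [bundle]

@[simp] lemma mem_kept {o : κ → ι} {D : Finset κ} {i : ι} {g : κ} :
    g ∈ kept o D i ↔ g ∈ D ∧ o g = i := by
  simp [kept]

lemma weight_nonneg {b : κ → ℝ} (hb : ∀ g, 0 ≤ b g) (S : Finset κ) : 0 ≤ weight b S :=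
  sum_nonneg fun g _ => hb g

lemma weight_mono {b : κ → ℝ} (hb : ∀ g, 0 ≤ b g) {S T : Finset κ} (h : S ⊆ T) :
    weight b S ≤ weight b T :=
  sum_le_sum_of_subset_of_nonneg h fun g _ _ => hb g

lemma weight_union {b : κ → ℝ} {S T : Finset κ} (h : Disjoint S T) :
    weight b (S ∪ T) = weight b S + weight b T :=
  sum_union h

lemma weight_sdiff {b : κ → ℝ} {S T : Finset κ} (h : S ⊆ T) :
    weight b (T \ S) = weight b T - weight b S := by
  have := sum_sdiff (f := b) h
  simp only [weight]; linarith

lemma weight_sdiff_singleton {b : κ → ℝ} {T : Finset κ} {g : κ} (h : g ∈ T) :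
    weight b (T \ {g}) = weight b T - b g := by
  rw [weight_sdiff (singleton_subset_iff.2 h)]; simp [weight]

lemma weight_insert_le {b : κ → ℝ} (hb : ∀ g, 0 ≤ b g) (T : Finset κ) (g : κ) :
    weight b (insert g T) ≤ b g + weight b T := by
  by_cases h : g ∈ T
  · rw [insert_eq_of_mem h]; linarith [hb g]
  · simp [weight, sum_insert h]

lemma le_weight {b : κ → ℝ} (hb : ∀ g, 0 ≤ b g) {T : Finset κ} {g : κ} (h : g ∈ T) :
    b g ≤ weight b T :=
  single_le_sum (f := b) (fun g _ => hb g) h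

/-- With two distinct items `g`, `g'`, a set weighs at most as much as the two sets left after
removing one of them. -/
lemma weight_le_add_sdiff {b : κ → ℝ} (hb : ∀ g, 0 ≤ b g) {T : Finset κ} {g g' : κ}
    (hg : g ∈ T) (hne : g ≠ g') :
    weight b T ≤ weight b (T \ {g}) + weight b (T \ {g'}) := by
  have h : g ∈ T \ {g'} := by simp [hg, hne]
  have := le_weight hb h
  have := weight_sdiff_singleton (b := b) hg
  linarith

/-- The comparisons of an agent with weights `b` who holds value `w` with a bundle `B`. -/
structure Good (α : ℝ) (b : κ → ℝ) (w : ℝ) (B : Finset κ) : Prop where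
  efx : ∀ g ∈ B, α * weight b (B \ {g}) ≤ w
  ef1 : B = ∅ ∨ ∃ g ∈ B, weight b (B \ {g}) ≤ w
  group : B.card ≤ 1 ∨ α * weight b B ≤ (α ^ 2 + 1) * w
  pair : weight b B ≤ 2 * w ∨
    ∃ g ∈ B, weight b (B \ {g}) ≤ w ∧ weight b (B \ {g}) * b g ≤ w ^ 2

lemma Good.mono {α : ℝ} {b : κ → ℝ} {w w' : ℝ} {B : Finset κ} (hw : w ≤ w')
    (hw0 : 0 ≤ w) (h : Good α b w B) : Good α b w' B where
  efx g hg := (h.efx g hg).trans hw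
  ef1 := h.ef1.imp id fun ⟨g, hg, hle⟩ => ⟨g, hg, hle.trans hw⟩
  group := h.group.imp id fun hle => hle.trans (by gcongr)
  pair := h.pair.imp (fun hle => hle.trans (by linarith))
    fun ⟨g, hg, hle, hle2⟩ => ⟨g, hg, hle.trans hw, hle2.trans (by gcongr)⟩

/-- A bundle consisting of an unenvied part and one item of small weight is `Good`. -/
lemma good_insert {α : ℝ} (hα0 : 0 ≤ α) (hα1 : α * (1 + α) ≤ 1) {b : κ → ℝ} (hb : ∀ g, 0 ≤ b g)
    {w : ℝ} {B : Finset κ} {g : κ} (hw : 0 ≤ w) (hB : weight b B ≤ w) (hg : b g ≤ α * w) :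
    Good α b w (insert g B) := by
  have hα : α ≤ 1 := by nlinarith
  have h1 : weight b (insert g B) ≤ (1 + α) * w := by
    linarith [weight_insert_le hb B g]
  have h2 : α * weight b (insert g B) ≤ w := by
    calc α * weight b (insert g B) ≤ α * ((1 + α) * w) := by gcongr
      _ = α * (1 + α) * w := by ring
      _ ≤ 1 * w := by gcongr
      _ = w := one_mul w
  refine ⟨fun g' _ => ?_, Or.inr ⟨g, mem_insert_self _ _, ?_⟩, Or.inr ?_, Or.inl ?_⟩
  · refine le_trans ?_ h2
    gcongr
    exact weight_mono hb sdiff_subset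
  · refine le_trans (weight_mono hb ?_) hB
    intro x; simp; tauto
  · nlinarith [mul_nonneg (sq_nonneg α) hw]
  · nlinarith

lemma good_of_card_le_one {α : ℝ} {b : κ → ℝ} {w : ℝ} {B : Finset κ} (hw : 0 ≤ w)
    (hB : B.card ≤ 1) : Good α b w B := by
  rcases B.eq_empty_or_nonempty with rfl | ⟨g, hg⟩
  · exact ⟨by simp, Or.inl rfl, Or.inl hB, Or.inl (by simpa [weight] using hw)⟩
  · have h0 : B \ {g} = ∅ := by
      ext x; simp only [mem_sdiff, mem_singleton, notMem_empty, iff_false, not_and, not_not]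
      exact fun hx => card_le_one.1 hB _ hx _ hg
    refine ⟨fun g' hg' => ?_, Or.inr ⟨g, hg, by simpa [h0, weight] using hw⟩, Or.inl hB,
      Or.inr ⟨g, hg, by simpa [h0, weight] using hw, by simpa [h0, weight] using sq_nonneg w⟩⟩
    rw [card_le_one.1 hB _ hg' _ hg]
    simpa [h0, weight] using hw

/-- EFX towards a bundle implies `Good`. -/
lemma good_of_efx {α : ℝ} (hα0 : 0 ≤ α) (hα : α ≤ 1) {b : κ → ℝ} (hb : ∀ g, 0 ≤ b g) {w : ℝ}
    {B : Finset κ} (hw : 0 ≤ w) (h : ∀ g ∈ B, weight b (B \ {g}) ≤ w) : Good α b w B := by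
  rcases le_or_gt B.card 1 with hc | hc
  · exact good_of_card_le_one hw hc
  obtain ⟨g, hg, g', hg', hne⟩ := one_lt_card.1 hc
  have h2 : weight b B ≤ 2 * w := by
    linarith [weight_le_add_sdiff hb hg hne, h g hg, h g' hg']
  refine ⟨fun x hx => ?_, Or.inr ⟨g, hg, h g hg⟩, Or.inr ?_, Or.inl h2⟩
  · exact (mul_le_of_le_one_left (weight_nonneg hb _) hα).trans (h x hx)
  · nlinarith [mul_le_mul_of_nonneg_left h2 hα0, mul_nonneg (sq_nonneg (α - 1)) hw]

/-- Only `group` needs work. Write x for the value of g and r for the rest. Removing another item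
leaves g, so αx ≤ 1. If x ≤ 1, then 2α ≤ α² + 1 suffices; if x ≥ 1, multiply by x and use rx ≤ 1 and
(1 - αx)(x - α) ≥ 0. -/
lemma good_of_sdiff_mul_le {α : ℝ} (hα0 : 0 ≤ α) (hα : α ≤ 1) {b : κ → ℝ} (hb : ∀ g, 0 ≤ b g)
    {B : Finset κ} (h : ∀ g ∈ B, α * weight b (B \ {g}) ≤ 1) {g : κ} (hg : g ∈ B)
    (h1 : weight b (B \ {g}) ≤ 1) (h2 : weight b (B \ {g}) * b g ≤ 1) : Good α b 1 B := by
  refine ⟨h, Or.inr ⟨g, hg, h1⟩, ?_, Or.inr ⟨g, hg, h1, by simpa using h2⟩⟩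
  rcases le_or_gt B.card 1 with hc | hc
  · exact Or.inl hc
  right
  obtain ⟨g', hg', hne⟩ := exists_mem_ne hc g
  have hx : α * b g ≤ 1 := by
    refine le_trans ?_ (h g' hg')
    gcongr
    exact le_weight hb (by simp [hg, hne.symm])
  have hsum : weight b B = b g + weight b (B \ {g}) := by
    rw [weight_sdiff_singleton hg]; ring
  rw [hsum]
  set r := weight b (B \ {g})
  rcases le_total (b g) 1 with hx1 | hx1
  · nlinarith [sq_nonneg (α - 1)]
  · have hpos : 0 < b g := by linarith
    refine le_of_mul_le_mul_right ?_ hpos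
    nlinarith [mul_nonneg (sub_nonneg.2 hx) (sub_nonneg.2 (hα.trans hx1)),
      mul_le_mul_of_nonneg_left h2 hα0]

/-- A smallest nonempty invariant subset is permuted by f. This supplies the cycles both of envy and
of chasing. -/
lemma exists_image_eq {β : Type*} [DecidableEq β] (f : β → β) {T : Finset β} (hT : T.Nonempty)
    (hf : ∀ x ∈ T, f x ∈ T) : ∃ S ⊆ T, S.Nonempty ∧ S.image f = S := by
  classical
  obtain ⟨S, hS, hmin⟩ := exists_min_image
    (T.powerset.filter fun S => S.Nonempty ∧ S.image f ⊆ S) card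
    ⟨T, by simp [hT, image_subset_iff]; exact hf⟩
  simp only [mem_filter, mem_powerset] at hS hmin
  refine ⟨S, hS.1, hS.2.1, eq_of_subset_of_card_le hS.2.2 ?_⟩
  exact hmin _ ⟨hS.2.2.trans hS.1, hS.2.1.image f, image_subset_image hS.2.2⟩

/-- Envy cycle elimination. -/
theorem exists_complete [Nonempty ι] {a : ι → κ → ℝ} (ha : ∀ i g, 0 ≤ a i g)
    {good : ι → ℝ → Finset κ → Prop} {z : ι → ℝ} {h₀ : κ → Option ι} (hmono : ∀ i w w' B, z i ≤ w → w ≤ w' → good i w B → good i w' B)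
    (hins : ∀ i w B g, z i ≤ w → weight (a i) B ≤ w → h₀ g = none → good i w (insert g B))
    (hz : ∀ i, z i ≤ weight (a i) (bundle h₀ i))
    (hgood : ∀ i j, good i (weight (a i) (bundle h₀ i)) (bundle h₀ j)) :
    ∃ o : κ → ι, (∀ i, z i ≤ weight (a i) (owned o i)) ∧
      ∀ i j, good i (weight (a i) (owned o i)) (owned o j) := by
  classical
  -- The first clause keeps the pool inside that of `h₀`, so `hins` applies to every item still in
  -- it. The extremal choice is a smallest pool, then a largest total value.
  let F : Finset (κ → Option ι) := univ.filter fun h => (∀ g, h g = none → h₀ g = none) ∧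
    (∀ i, z i ≤ weight (a i) (bundle h i)) ∧
    ∀ i j, good i (weight (a i) (bundle h i)) (bundle h j)
  have hF : F.Nonempty := ⟨h₀, by simp only [F, mem_filter]; exact ⟨mem_univ _, fun _ h => h, hz, hgood⟩⟩
  let pool : (κ → Option ι) → Finset κ := fun h => univ.filter fun g => h g = none
  obtain ⟨h₁, hh₁, hmin⟩ := exists_min_image F (fun h => (pool h).card) hF
  obtain ⟨h, hh, hmax⟩ := exists_max_image (F.filter fun h => (pool h).card = (pool h₁).card)
    (fun h => ∑ i, weight (a i) (bundle h i)) ⟨h₁, by simp [hh₁]⟩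
  obtain ⟨hhF, hhc⟩ := mem_filter.1 hh
  obtain ⟨-, hh0, hhz, hhg⟩ := mem_filter.1 hhF
  have hnone : ∀ g, h g ≠ none := by
    intro g hg
    -- Otherwise each `j` is envied by some `f j`, and passing bundles along a cycle of `f` raises
    -- the total value without changing the pool.
    obtain ⟨j, hj⟩ : ∃ j, ∀ i, weight (a i) (bundle h j) ≤ weight (a i) (bundle h i) := by
      by_contra! hcon
      choose f hf using hcon
      obtain ⟨S, -, hSne, hS⟩ := exists_image_eq f (T := univ) univ_nonempty (by simp)
      have hinj : Set.InjOn f S := card_image_iff.1 (by rw [hS])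
      have hmem : ∀ x ∈ S, f x ∈ S := fun x hx => hS ▸ mem_image_of_mem f hx
      let p : ι → ι := fun j => if j ∈ S then f j else j
      have hp : Function.Injective p := by
        intro x y hxy
        by_cases hx : x ∈ S <;> by_cases hy : y ∈ S <;> simp only [p, hx, hy, if_true, if_false] at hxy
        · exact hinj hx hy hxy
        · exact absurd (hxy ▸ hmem x hx) hy
        · exact absurd (hxy ▸ hmem y hy) hx
        · exact hxy
      have hpb : Function.Bijective p := Finite.injective_iff_bijective.1 hp
      let h' : κ → Option ι := fun g => (h g).map p
      have hb : ∀ j, bundle h' (p j) = bundle h j := by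
        intro j; ext g
        simp only [mem_bundle, h', Option.map_eq_some_iff]
        constructor
        · rintro ⟨x, hx, hxj⟩; rw [hx, hp hxj]
        · intro hx; exact ⟨j, hx, rfl⟩
      have hle : ∀ j, weight (a (p j)) (bundle h (p j)) ≤ weight (a (p j)) (bundle h' (p j)) := by
        intro j
        rw [hb]
        by_cases hj : j ∈ S
        · simp only [p, hj, if_true]; exact (hf j).le
        · simp [p, hj]
      have hle' : ∀ i, weight (a i) (bundle h i) ≤ weight (a i) (bundle h' i) := by
        intro i; obtain ⟨j, rfl⟩ := hpb.2 i; exact hle j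
      have hpool : pool h' = pool h := by
        ext g; simp [pool, h']
      have hmem' : h' ∈ F.filter fun h => (pool h).card = (pool h₁).card := by
        rw [mem_filter, hpool]
        refine ⟨mem_filter.2 ⟨mem_univ _, ?_, fun i => (hhz i).trans (hle' i), fun i j => ?_⟩, hhc⟩
        · intro g hg; exact hh0 g (by simpa [h'] using hg)
        · obtain ⟨k, rfl⟩ := hpb.2 j
          rw [hb]
          exact hmono _ _ _ _ (hhz i) (hle' i) (hhg i k)
      have := hmax h' hmem'
      refine absurd this (not_le.2 (sum_lt_sum (fun i _ => hle' i) ?_))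
      obtain ⟨x, hx⟩ := hSne
      refine ⟨p x, mem_univ _, ?_⟩
      rw [hb]
      simp only [p, hx, if_true]
      exact hf x
    let h' : κ → Option ι := Function.update h g (some j)
    have hbj : bundle h' j = insert g (bundle h j) := by
      ext x
      by_cases hx : x = g
      · subst hx; simp [h']
      · simp [h', hx]
    have hbi : ∀ i, i ≠ j → bundle h' i = bundle h i := by
      intro i hi
      ext x
      by_cases hx : x = g
      · subst hx; simp [h', hg, hi.symm]
      · simp [h', hx]
    have hle : ∀ i, weight (a i) (bundle h i) ≤ weight (a i) (bundle h' i) := by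
      intro i
      by_cases hi : i = j
      · rw [hi, hbj]; exact weight_mono (ha j) (subset_insert _ _)
      · rw [hbi i hi]
    have hpool : pool h' ⊂ pool h := by
      refine Finset.ssubset_iff_subset_ne.2 ⟨fun x => ?_, fun heq => ?_⟩
      · by_cases hx : x = g
        · subst hx; simp [pool, h']
        · simp [pool, h', hx]
      · have : g ∈ pool h' := by rw [heq]; simp [pool, hg]
        simp [pool, h'] at this
    refine absurd (hmin h' (mem_filter.2 ⟨mem_univ _, fun x hx => hh0 x ?_,
      fun i => (hhz i).trans (hle i), fun i k => hmono _ _ _ _ (hhz i) (hle i) ?_⟩))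
      (not_le.2 (hhc ▸ card_lt_card hpool))
    · have := hpool.1 (show x ∈ pool h' by simp [pool, hx])
      simpa [pool] using this
    · by_cases hk : k = j
      · rw [hk, hbj]; exact hins _ _ _ _ (hhz i) (hj i) (hh0 g hg)
      · rw [hbi k hk]; exact hhg i k
  have hsome : ∀ g, ∃ i, h g = some i := fun g => Option.ne_none_iff_exists'.1 (hnone g)
  choose o ho using hsome
  have hob : ∀ i, owned o i = bundle h i := by
    intro i; ext g; simp [ho]
  exact ⟨o, by simpa only [hob] using hhz, by simpa only [hob] using hhg⟩

end Core

/-! ### Discarding items from an optimal allocation -/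

section Chase

variable {ι κ : Type*} [Fintype ι] [DecidableEq ι] [Fintype κ] [DecidableEq κ]

/-- Agent `k` prefers the kept items of `j` to her own kept items, by more than the factor `1 / α`
if she has kept everything. -/
def Chases (α : ℝ) (a : ι → κ → ℝ) (o : κ → ι) (D : Finset κ) (k j : ι) : Prop :=
  weight (a k) (kept o D k) < weight (a k) (kept o D j) ∧
    (kept o D k = owned o k → weight (a k) (kept o D k) < α * weight (a k) (kept o D j))

/-- Every agent has kept everything or is chased. -/
def AllChased (α : ℝ) (a : ι → κ → ℝ) (o : κ → ι) (D : Finset κ) : Prop :=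
  ∀ j, kept o D j = owned o j ∨ ∃ k, Chases α a o D k j

/-- A complete allocation of maximum Nash welfare that gives every agent the value one. -/
structure Optimal (a : ι → κ → ℝ) (o : κ → ι) : Prop where
  pos : ∀ i g, 0 < a i g
  one : ∀ i, weight (a i) (owned o i) = 1
  prod_le_one : ∀ o' : κ → ι, ∏ i, weight (a i) (owned o' i) ≤ 1

variable {α : ℝ} {a : ι → κ → ℝ} {o : κ → ι} {D : Finset κ}

lemma Chases.ne {k j : ι} (h : Chases α a o D k j) : k ≠ j := by
  rintro rfl; exact lt_irrefl _ h.1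

lemma kept_subset (o : κ → ι) (D : Finset κ) (i : ι) : kept o D i ⊆ owned o i := by
  intro g; simp

namespace Optimal

lemma nonneg (h : Optimal a o) (i : ι) (g : κ) : 0 ≤ a i g := (h.pos i g).le

/-- The product of some of the values is at most one if all other values are at least one. -/
lemma prod_le (h : Optimal a o) (o' : κ → ι) (S : Finset ι)
    (h1 : ∀ k, k ∉ S → 1 ≤ weight (a k) (owned o' k)) :
    ∏ k ∈ S, weight (a k) (owned o' k) ≤ 1 := by
  refine le_trans ?_ (h.prod_le_one o')
  rw [← prod_mul_prod_compl S]
  exact le_mul_of_one_le_right (prod_nonneg fun k _ => weight_nonneg (h.nonneg k) _)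
    (one_le_prod fun k hk => h1 k (mem_compl.1 hk))

lemma kept_le_one (h : Optimal a o) (D : Finset κ) (i : ι) : weight (a i) (kept o D i) ≤ 1 := by
  rw [← h.one i]; exact weight_mono (h.nonneg i) (kept_subset _ _ _)

end Optimal

/-- The agents in `T` pass their kept items on along `f`. -/
def reroute (o : κ → ι) (D : Finset κ) (T : Finset ι) (f : ι → ι) (g : κ) : ι :=
  if g ∈ D ∧ o g ∈ T then f (o g) else o g

/-- Valid whether or not `k` passes on her own kept items: those she discarded stay with her in
either case. -/
lemma weight_reroute (h : Optimal a o) {T : Finset ι} {f : ι → ι} {s k : ι} (hs : s ∈ T)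
    (hf : f s = k) (hsk : k ≠ s) :
    1 - weight (a k) (kept o D k) + weight (a k) (kept o D s) ≤
      weight (a k) (owned (reroute o D T f) k) := by
  rw [← h.one k, ← weight_sdiff (kept_subset o D k), ← weight_union]
  · refine weight_mono (h.nonneg k) fun g => ?_
    simp only [mem_union, mem_sdiff, mem_owned, mem_kept, reroute]
    rintro (⟨rfl, hg⟩ | ⟨hg, rfl⟩)
    · rw [if_neg]; tauto
    · rw [if_pos ⟨hg, hs⟩, hf]
  · rw [disjoint_left]
    intro g
    simp only [mem_sdiff, mem_owned, mem_kept]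
    rintro ⟨rfl, -⟩ ⟨-, h2⟩
    exact hsk h2

lemma weight_reroute_of_notMem (h : Optimal a o) {T : Finset ι} {f : ι → ι} {s k : ι} (hs : s ∈ T)
    (hf : f s = k) (hk : k ∉ T) :
    1 + weight (a k) (kept o D s) ≤ weight (a k) (owned (reroute o D T f) k) := by
  rw [← h.one k, ← weight_union]
  · refine weight_mono (h.nonneg k) fun g => ?_
    simp only [mem_union, mem_owned, mem_kept, reroute]
    rintro (rfl | ⟨hg, rfl⟩)
    · rw [if_neg]; tauto
    · rw [if_pos ⟨hg, hs⟩, hf]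
  · rw [disjoint_left]
    intro g
    simp only [mem_owned, mem_kept]
    rintro rfl ⟨-, rfl⟩
    exact hk hs

lemma one_le_weight_reroute (h : Optimal a o) {T : Finset ι} {f : ι → ι} {k : ι} (hk : k ∉ T) :
    1 ≤ weight (a k) (owned (reroute o D T f) k) := by
  rw [← h.one k]
  refine weight_mono (h.nonneg k) fun g => ?_
  simp only [mem_owned, reroute]
  rintro rfl
  rw [if_neg]; tauto

/-- If agent `i` has not kept everything, then her kept items can be passed on so that only she
loses and some agent who has kept everything gains more than `1 / α`. -/
theorem exists_augmentation (h : Optimal a o) (hD : AllChased α a o D) {i : ι}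
    (hi : kept o D i ≠ owned o i) :
    ∃ (o' : κ → ι) (l : ι), kept o D l = owned o l ∧
      1 < α * (weight (a l) (owned o' l) - 1) ∧ 1 < weight (a l) (owned o' l) ∧
      (∀ k, k ≠ i → 1 ≤ weight (a k) (owned o' k)) ∧ ∀ g, g ∉ D → o' g = o g := by
  classical
  -- `f` sends an agent to a chaser and fixes those who kept everything, so the orbit of `i` stops
  -- at the first such agent.
  have hex : ∀ j, ∃ k, (kept o D j = owned o j → k = j) ∧
      (kept o D j ≠ owned o j → Chases α a o D k j) := by
    intro j
    by_cases hj : kept o D j = owned o j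
    · exact ⟨j, fun _ => rfl, fun hj' => absurd hj hj'⟩
    · obtain ⟨k, hk⟩ := (hD j).resolve_left hj
      exact ⟨k, fun hj' => absurd hj' hj, fun _ => hk⟩
  choose f hfull hf using hex
  let C : Finset ι := univ.filter fun k => ∃ s, f^[s] i = k
  have hC : ∀ k, k ∈ C ↔ ∃ s, f^[s] i = k := by simp [C]
  have hiC : i ∈ C := (hC i).2 ⟨0, rfl⟩
  have hfC : ∀ k ∈ C, f k ∈ C := by
    intro k hk
    obtain ⟨s, rfl⟩ := (hC k).1 hk
    exact (hC _).2 ⟨s + 1, Function.iterate_succ_apply' f s i⟩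
  have hhit : ∀ k ∈ C, k ≠ i → ∃ p ∈ C, kept o D p ≠ owned o p ∧ f p = k := by
    intro k hk hki
    have hk := (hC k).1 hk
    have hs := Nat.find_spec hk
    have hmin := fun t => Nat.find_min hk (m := t)
    generalize Nat.find hk = s at hs hmin
    cases s with
    | zero => exact absurd hs.symm hki
    | succ s =>
      rw [Function.iterate_succ_apply'] at hs
      refine ⟨f^[s] i, (hC _).2 ⟨s, rfl⟩, fun hfu => ?_, hs⟩
      -- A predecessor who kept everything is fixed by `f`, so she would be `k` herself, reached one
      -- step earlier.
      exact hmin s (Nat.lt_succ_self s) ((hfull _ hfu).symm.trans hs)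
  have hgain : ∀ T : Finset ι, ∀ p ∈ T, kept o D p ≠ owned o p →
      1 < weight (a (f p)) (owned (reroute o D T f) (f p)) := by
    intro T p hp hpf
    have hch := hf p hpf
    have := weight_reroute (D := D) h (f := f) hp rfl hch.ne
    linarith [hch.1]
  -- Otherwise the orbit contains a cycle of chasers; shifting along it alone gives each of its
  -- members more than one and harms nobody, against optimality.
  obtain ⟨l, hlC, hl⟩ : ∃ l ∈ C, kept o D l = owned o l := by
    by_contra! hno
    obtain ⟨S, hSC, ⟨x, hx⟩, hS⟩ := exists_image_eq f ⟨i, hiC⟩ hfC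
    have hS1 : ∀ k ∈ S, 1 < weight (a k) (owned (reroute o D S f) k) := by
      intro k hk
      rw [← hS] at hk
      obtain ⟨p, hp, rfl⟩ := mem_image.1 hk
      exact hgain S p hp (hno p (hSC hp))
    have := h.prod_le (reroute o D S f) {x} fun k _ => by
      by_cases hk : k ∈ S
      · exact (hS1 k hk).le
      · exact one_le_weight_reroute h hk
    rw [prod_singleton] at this
    exact absurd this (not_le.2 (hS1 x hx))
  have hli : l ≠ i := by rintro rfl; exact hi hl
  -- `l` is left out, so she retains her whole bundle and adds that of her predecessor.
  let T : Finset ι := C.filter fun k => kept o D k ≠ owned o k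
  refine ⟨reroute o D T f, l, hl, ?_, ?_, fun k hk => ?_, fun g hg => ?_⟩
  · obtain ⟨p, hpC, hpf, hpl⟩ := hhit l hlC hli
    have hch := (hf p hpf)
    rw [hpl] at hch
    have h1 := weight_reroute_of_notMem (D := D) h (f := f) (T := T)
      (mem_filter.2 ⟨hpC, hpf⟩) hpl (by simp [T, hl])
    have h2 := hch.2 hl
    have h3 := hch.1
    rw [hl, h.one] at h2 h3
    have hα : 0 < α := by
      by_contra hα
      nlinarith
    nlinarith
  · obtain ⟨p, hpC, hpf, hpl⟩ := hhit l hlC hli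
    exact hpl ▸ hgain T p (mem_filter.2 ⟨hpC, hpf⟩) hpf
  · by_cases hkC : k ∈ C
    · obtain ⟨p, hpC, hpf, rfl⟩ := hhit k hkC hk
      exact (hgain T p (mem_filter.2 ⟨hpC, hpf⟩) hpf).le
    · exact one_le_weight_reroute h fun hkT => hkC (mem_filter.1 hkT).1
  · simp [reroute, hg]

/-- Every agent keeps at least a `1 / (1 + α)` fraction of her value. -/
theorem one_le_mul_weight_kept (hα0 : 0 ≤ α) (h : Optimal a o) (hD : AllChased α a o D) (j : ι) :
    1 ≤ (1 + α) * weight (a j) (kept o D j) := by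
  by_cases hj : kept o D j = owned o j
  · rw [hj, h.one]; linarith
  obtain ⟨o', l, hl, hl1, -, hge, ho'⟩ := exists_augmentation h hD hj
  have hjl : j ≠ l := by rintro rfl; exact hj hl
  -- With z the kept value of `j` and W the new value of `l`, (1 - z)W ≤ 1 and W > 1 + 1/α force z >
  -- 1/(1+α).
  have h1 := h.prod_le o' {j, l} fun k hk => hge k (by rintro rfl; simp at hk)
  rw [prod_pair hjl] at h1
  have h2 : 1 - weight (a j) (kept o D j) ≤ weight (a j) (owned o' j) := by
    rw [← h.one j, ← weight_sdiff (kept_subset o D j)]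
    refine weight_mono (h.nonneg j) fun g => ?_
    simp only [mem_sdiff, mem_owned, mem_kept]
    rintro ⟨rfl, hg⟩
    exact ho' g (by tauto)
  have hα : 0 < α := by
    rcases hα0.eq_or_lt with h0 | h0
    · rw [← h0] at hl1; linarith
    · exact h0
  set W := weight (a l) (owned o' l)
  have hW : 0 ≤ W := weight_nonneg (h.nonneg l) _
  have h3 : (1 - weight (a j) (kept o D j)) * W ≤ 1 :=
    (mul_le_mul_of_nonneg_right h2 hW).trans h1
  have hz := h.kept_le_one D j
  nlinarith [mul_le_mul_of_nonneg_left hl1.le (sub_nonneg.2 hz)]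

lemma owned_update (o : κ → ι) {g : κ} {i : ι} :
    owned (Function.update o g i) i = insert g (owned o i) := by
  ext x
  by_cases hx : x = g
  · subst hx; simp
  · simp [hx]

lemma owned_update_of_ne (o : κ → ι) {g : κ} {i k : ι} (hk : k ≠ i) :
    owned (Function.update o g i) k = owned o k \ {g} := by
  ext x
  by_cases hx : x = g
  · subst hx; simp [hk.symm]
  · simp [hx]

/-- Moving one item does not increase the product. -/
lemma Optimal.move (h : Optimal a o) {g : κ} {i : ι} (hg : o g ≠ i) :
    (1 + a i g) * (1 - a (o g) g) ≤ 1 := by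
  have h1 := h.prod_le (Function.update o g i) {i, o g} fun k hk => by
    simp only [mem_insert, mem_singleton, not_or] at hk
    rw [owned_update_of_ne o hk.1, sdiff_eq_self_of_disjoint, h.one]
    simpa using Ne.symm hk.2
  rw [prod_pair hg.symm, owned_update, owned_update_of_ne o hg,
    weight_sdiff_singleton (by simp), h.one] at h1
  have h2 : weight (a i) (insert g (owned o i)) = 1 + a i g := by
    rw [← h.one i, weight, sum_insert (by simpa using hg), add_comm]; rfl
  rwa [h2] at h1

/-- Items that nobody keeps have small value. -/
theorem le_mul_weight_kept (hα0 : 0 ≤ α) (hα1 : α ≤ 1) (h : Optimal a o) (hD : AllChased α a o D)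
    {g : κ} (hg : g ∉ D) (i : ι) : a i g ≤ α * weight (a i) (kept o D i) := by
  have hgz : a (o g) g ≤ 1 - weight (a (o g)) (kept o D (o g)) := by
    rw [← h.one (o g), ← weight_sdiff (kept_subset o D _)]
    exact le_weight (h.nonneg _) (by simp [hg])
  have hz := one_le_mul_weight_kept hα0 h hD (o g)
  have hz1 := h.kept_le_one D (o g)
  by_cases hgi : o g = i
  · subst hgi; linarith
  by_cases hi : kept o D i = owned o i
  · rw [hi, h.one]
    have := h.move hgi
    have h3 : (1 + a i g) * weight (a (o g)) (kept o D (o g)) ≤ 1 := by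
      refine le_trans ?_ this
      have := h.nonneg i g
      gcongr
      linarith
    have h4 : (1 + a i g) * 1 ≤ (1 + a i g) * ((1 + α) * weight (a (o g)) (kept o D (o g))) :=
      mul_le_mul_of_nonneg_left hz (by linarith [h.nonneg i g])
    nlinarith
  -- Augment from `i` and also move `g` to her. She then has more than α, the former owner of `g` at
  -- least 1/(1+α), and `l` more than (1+α)/α; the product exceeds one.
  by_contra! hlt
  obtain ⟨o', l, hl, hl1, hl2, hge, ho'⟩ := exists_augmentation h hD hi
  have hil : i ≠ l := by rintro rfl; exact hi hl
  have hgl : o g ≠ l := by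
    rintro rfl
    have : g ∈ kept o D (o g) := by rw [hl]; simp
    simp [hg] at this
  have hgo' : o' g = o g := ho' g hg
  set o'' := Function.update o' g i with ho''
  have hne : ∀ k, k ≠ i → k ≠ o g → owned o'' k = owned o' k := by
    intro k hk hkg
    rw [owned_update_of_ne o' hk, sdiff_eq_self_of_disjoint]
    simpa [hgo'] using Ne.symm hkg
  have hprod := h.prod_le o'' {i, o g, l} fun k hk => by
    simp only [mem_insert, mem_singleton, not_or] at hk
    rw [hne k hk.1 hk.2.1]
    exact hge k hk.1
  rw [prod_insert (by simp [hil, Ne.symm hgi]), prod_pair hgl, hne l hil.symm hgl.symm] at hprod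
  have h1 : 1 - weight (a i) (kept o D i) + a i g ≤ weight (a i) (owned o'' i) := by
    have h1' : 1 - weight (a i) (kept o D i) ≤ weight (a i) (owned o' i) := by
      rw [← h.one i, ← weight_sdiff (kept_subset o D i)]
      refine weight_mono (h.nonneg i) fun x => ?_
      simp only [mem_sdiff, mem_owned, mem_kept]
      rintro ⟨rfl, hx⟩
      exact ho' x (by tauto)
    have h2' : weight (a i) (insert g (owned o' i)) = a i g + weight (a i) (owned o' i) :=
      sum_insert (by simpa [hgo'] using hgi)
    rw [owned_update, h2']
    linarith
  have h2 : weight (a (o g)) (kept o D (o g)) ≤ weight (a (o g)) (owned o'' (o g)) := by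
    rw [owned_update_of_ne o' hgi, weight_sdiff_singleton (by simpa using hgo')]
    linarith [hge _ hgi]
  set z := weight (a (o g)) (kept o D (o g))
  set W := weight (a l) (owned o' l)
  have hzi := h.kept_le_one D i
  have hα : 0 < α := by
    rcases hα0.eq_or_lt with h0 | h0
    · rw [← h0] at hl1; linarith
    · exact h0
  have h3 : α < weight (a i) (owned o'' i) := by nlinarith
  have hz0 : 0 < z := by nlinarith
  have hzW : 0 < z * W := mul_pos hz0 (by linarith)
  have h4 : α * (z * W) < 1 := by
    calc α * (z * W) < weight (a i) (owned o'' i) * (z * W) := mul_lt_mul_of_pos_right h3 hzW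
      _ ≤ weight (a i) (owned o'' i) * (weight (a (o g)) (owned o'' (o g)) * W) := by
        have : 0 ≤ weight (a i) (owned o'' i) := by linarith
        have : 0 ≤ W := by linarith
        gcongr
      _ ≤ 1 := hprod
  nlinarith

/-- The envy of an agent towards a part of another bundle. -/
lemma Optimal.exists_sdiff_mul_le (h : Optimal a o) {i k : ι} (hik : k ≠ i) {B : Finset κ}
    (hB : B ⊆ owned o k) (hne : B.Nonempty) :
    ∃ g ∈ B, weight (a i) (B \ {g}) ≤ 1 ∧ weight (a i) (B \ {g}) * a i g ≤ 1 := by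
  obtain ⟨g, hg, hmax⟩ := exists_max_image B (a i) hne
  refine ⟨g, hg, ?_⟩
  set r := weight (a i) (B \ {g}) with hr
  have hr0 : 0 ≤ r := weight_nonneg (h.nonneg i) _
  have hx := h.nonneg i g
  have hitem : ∀ x ∈ B, a i x ≤ (1 + a i x) * a k x := by
    intro x hxB
    have hxk : o x = k := by simpa using hB hxB
    have := h.move (g := x) (i := i) (by rw [hxk]; exact hik)
    rw [hxk] at this
    linarith
  -- Any bound y on the items other than `g` will do. Taking y to be the value of `g` gives r ≤ 1;
  -- taking y = r gives the product bound.
  have key : ∀ y, (∀ x ∈ B \ {g}, a i x ≤ y) → 0 ≤ y → r * (1 + a i g) ≤ 1 + y := by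
    intro y hy hy0
    have h1 : r ≤ (1 + y) * weight (a k) (B \ {g}) := by
      rw [hr, weight, weight, mul_sum]
      refine sum_le_sum fun x hxB => (hitem x (mem_sdiff.1 hxB).1).trans ?_
      have := h.nonneg k x
      gcongr
      exact hy x hxB
    have h2 : weight (a k) (B \ {g}) ≤ 1 - a k g := by
      rw [weight_sdiff_singleton hg]
      linarith [weight_mono (h.nonneg k) hB, h.one k]
    have h3 : r ≤ (1 + y) * (1 - a k g) := h1.trans (by gcongr)
    have h4 := hitem g hg
    calc r * (1 + a i g) ≤ (1 + y) * (1 - a k g) * (1 + a i g) := by gcongr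
      _ = (1 + y) * ((1 + a i g) - (1 + a i g) * a k g) := by ring
      _ ≤ (1 + y) * 1 := by gcongr; linarith
      _ = 1 + y := mul_one _
  have h1 := key (a i g) (fun x hxB => hmax x (mem_sdiff.1 hxB).1) hx
  have h2 := key r (fun x hxB => le_weight (h.nonneg i) hxB) hr0
  exact ⟨by nlinarith, by linarith⟩

/-- The kept items of a minimal configuration. -/
theorem exists_good_kept (hα0 : 0 ≤ α) (hα1 : α ≤ 1) (h : Optimal a o) :
    ∃ D : Finset κ, AllChased α a o D ∧
      ∀ i j, Good α (a i) (weight (a i) (kept o D i)) (kept o D j) := by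
  classical
  obtain ⟨D, hD, hmin⟩ := exists_min_image (univ.filter (AllChased α a o)) card
    ⟨univ, mem_filter.2 ⟨mem_univ _, fun j => Or.inl (by ext; simp)⟩⟩
  replace hD := (mem_filter.1 hD).2
  -- If this failed, `i` would chase `j` after `g` is discarded, and `D.erase g` would contradict
  -- minimality.
  have hno : ∀ i j, ∀ g ∈ kept o D j,
      weight (a i) (kept o D i) < weight (a i) (kept o D j \ {g}) →
      kept o D i = owned o i ∧
        α * weight (a i) (kept o D j \ {g}) ≤ weight (a i) (kept o D i) := by
    intro i j g hg hlt
    by_contra hcon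
    push Not at hcon
    obtain ⟨hgD, hgj⟩ := mem_kept.1 hg
    have hij : i ≠ j := by
      rintro rfl
      exact absurd hlt (not_lt.2 (weight_mono (h.nonneg i) sdiff_subset))
    have hkj : kept o (D.erase g) j = kept o D j \ {g} := by
      ext x; simp; tauto
    have hk : ∀ k, k ≠ j → kept o (D.erase g) k = kept o D k := by
      intro k hk; ext x; simp only [mem_kept, mem_erase]
      have : o x = k → x ≠ g := by
        rintro rfl rfl
        exact hk hgj
      tauto
    have hnf : kept o (D.erase g) j ≠ owned o j := by
      intro heq
      have : g ∈ kept o (D.erase g) j := by rw [heq]; simpa using hgj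
      simp at this
    have hch : AllChased α a o (D.erase g) := by
      intro k
      by_cases hkj' : k = j
      · rw [hkj']
        refine Or.inr ⟨i, ?_⟩
        rw [Chases, hk i hij, hkj]
        exact ⟨hlt, hcon⟩
      · rw [hk k hkj']
        refine (hD k).imp id fun ⟨w, hw⟩ => ⟨w, ?_⟩
        -- A chaser who is `j` herself has just become poorer, so she still chases; the factor
        -- clause is void as she no longer has everything.
        by_cases hwj : w = j
        · subst hwj
          refine ⟨?_, fun hf => absurd hf hnf⟩
          rw [hk k hkj', hkj]
          exact (weight_mono (h.nonneg _) sdiff_subset).trans_lt hw.1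
        · rw [Chases, hk k hkj', hk w hwj]; exact hw
    exact absurd (hmin _ (mem_filter.2 ⟨mem_univ _, hch⟩)) (not_le.2 (card_erase_lt_of_mem hgD))
  refine ⟨D, hD, fun i j => ?_⟩
  have hz0 : 0 ≤ weight (a i) (kept o D i) := weight_nonneg (h.nonneg i) _
  by_cases hij : j = i
  · rw [hij]
    exact good_of_efx hα0 hα1 (h.nonneg i) hz0 fun g _ => weight_mono (h.nonneg i) sdiff_subset
  by_cases hi : kept o D i = owned o i
  · have hz : weight (a i) (kept o D i) = 1 := by rw [hi, h.one]
    have hefx : ∀ g ∈ kept o D j, α * weight (a i) (kept o D j \ {g}) ≤ 1 := by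
      intro g hg
      rw [← hz]
      by_cases hlt : weight (a i) (kept o D i) < weight (a i) (kept o D j \ {g})
      · exact (hno i j g hg hlt).2
      · exact (mul_le_of_le_one_left (weight_nonneg (h.nonneg i) _) hα1).trans (not_lt.1 hlt)
    rw [hz]
    rcases (kept o D j).eq_empty_or_nonempty with h0 | h0
    · rw [h0]; exact good_of_card_le_one zero_le_one (by simp)
    · obtain ⟨g, hg, h1, h2⟩ := h.exists_sdiff_mul_le hij (kept_subset o D j) h0
      exact good_of_sdiff_mul_le hα0 hα1 (h.nonneg i) hefx hg h1 h2
  · refine good_of_efx hα0 hα1 (h.nonneg i) hz0 fun g hg => ?_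
    by_contra! hlt
    exact hi (hno i j g hg hlt).1

/-- A complete allocation all of whose comparisons are good and that gives every agent at least a
`1 / (1 + α)` fraction of her value in an optimal allocation. -/
theorem Optimal.exists_good (hα0 : 0 ≤ α) (hα1 : α * (1 + α) ≤ 1) [Nonempty ι]
    (h : Optimal a o) : ∃ o' : κ → ι, (∀ i, 1 ≤ (1 + α) * weight (a i) (owned o' i)) ∧
      ∀ i j, Good α (a i) (weight (a i) (owned o' i)) (owned o' j) := by
  have hα : α ≤ 1 := by nlinarith
  obtain ⟨D, hD, hgood⟩ := exists_good_kept hα0 hα h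
  let h₀ : κ → Option ι := fun g => if g ∈ D then some (o g) else none
  have hb : ∀ i, bundle h₀ i = kept o D i := by
    intro i; ext g; simp [h₀]
  have hz0 : ∀ i, 0 ≤ weight (a i) (kept o D i) := fun i => weight_nonneg (h.nonneg i) _
  obtain ⟨o', ho1, ho2⟩ := exists_complete (a := a) h.nonneg (good := fun i w B => Good α (a i) w B)
    (z := fun i => weight (a i) (kept o D i)) (h₀ := h₀)
    (fun i w w' B hw hww hg => hg.mono hww ((hz0 i).trans hw))
    (fun i w B g hw hB hg => good_insert hα0 hα1 (h.nonneg i) ((hz0 i).trans hw) hB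
      ((le_mul_weight_kept hα0 hα h hD (by simpa [h₀] using hg) i).trans (by gcongr)))
    (fun i => by rw [hb]) (fun i j => by rw [hb, hb]; exact hgood i j)
  refine ⟨o', fun i => (one_le_mul_weight_kept hα0 h hD i).trans ?_, ho2⟩
  have := ho1 i
  gcongr

end Chase

/-! ### Normalization and passage to zero values -/

section Existence

variable {ι κ : Type*} [Fintype ι] [DecidableEq ι] [Fintype κ] [DecidableEq κ]

lemma weight_smul (c : ℝ) (b : κ → ℝ) (S : Finset κ) :
    weight (fun g => c * b g) S = c * weight b S := by
  simp [weight, mul_sum]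

lemma Good.smul {α c : ℝ} (hc : 0 ≤ c) {b : κ → ℝ} {w : ℝ} {B : Finset κ} (h : Good α b w B) :
    Good α (fun g => c * b g) (c * w) B := by
  have hS : ∀ {S r}, weight b S ≤ r → weight (fun g => c * b g) S ≤ c * r := fun hle => by
    rw [weight_smul]; exact mul_le_mul_of_nonneg_left hle hc
  refine ⟨fun g hg => ?_, h.ef1.imp id fun ⟨g, hg, hle⟩ => ⟨g, hg, hS hle⟩,
    h.group.imp id fun hle => ?_, ?_⟩
  · rw [weight_smul]; linarith [mul_le_mul_of_nonneg_left (h.efx g hg) hc]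
  · rw [weight_smul]; linarith [mul_le_mul_of_nonneg_left hle hc]
  · rcases h.pair with hle | ⟨g, hg, h1, h2⟩
    · exact Or.inl ((hS hle).trans_eq (by ring))
    · refine Or.inr ⟨g, hg, hS h1, ?_⟩
      rw [weight_smul]; linarith [mul_le_mul_of_nonneg_left h2 (sq_nonneg c)]

/-- A complete allocation all of whose comparisons are good and whose Nash welfare is at least a
`1 / (1 + α)` fraction of that of any other one. -/
structure Solution (α : ℝ) (a : ι → κ → ℝ) (o : κ → ι) : Prop where
  good : ∀ i j, Good α (a i) (weight (a i) (owned o i)) (owned o j)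
  prod_le : ∀ o' : κ → ι, ∏ i, weight (a i) (owned o' i) ≤
    (1 + α) ^ Fintype.card ι * ∏ i, weight (a i) (owned o i)

variable {α : ℝ} {a : ι → κ → ℝ}

/-- With enough items of positive value the maximum product is positive, so each agent can be
rescaled by her value in a maximizer; `Good` is invariant under scaling. -/
theorem exists_solution_of_pos [Nonempty ι] (hα0 : 0 ≤ α) (hα1 : α * (1 + α) ≤ 1)
    (ha : ∀ i g, 0 < a i g) (hcard : Fintype.card ι ≤ Fintype.card κ) :
    ∃ o : κ → ι, Solution α a o := by
  have ha0 : ∀ i g, 0 ≤ a i g := fun i g => (ha i g).le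
  obtain ⟨e⟩ := Function.Embedding.nonempty_of_card_le hcard
  obtain ⟨o, -, hmax⟩ := exists_max_image (univ : Finset (κ → ι))
    (fun o => ∏ i, weight (a i) (owned o i)) ⟨fun _ => Classical.arbitrary ι, mem_univ _⟩
  replace hmax := fun o' => hmax o' (mem_univ _)
  have hprod : 0 < ∏ i, weight (a i) (owned o i) := by
    refine lt_of_lt_of_le (prod_pos fun i _ => ?_) (hmax (Function.invFun e))
    refine (ha i (e i)).trans_le (le_weight (ha0 i) ?_)
    simp [Function.leftInverse_invFun e.injective i]
  have hpos : ∀ i, 0 < weight (a i) (owned o i) := by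
    intro i
    refine lt_of_le_of_ne (weight_nonneg (ha0 i) _) fun h0 => hprod.ne' ?_
    exact prod_eq_zero (mem_univ i) h0.symm
  have hopt : Optimal (fun i g => (weight (a i) (owned o i))⁻¹ * a i g) o := by
    refine ⟨fun i g => mul_pos (inv_pos.2 (hpos i)) (ha i g), fun i => ?_, fun o' => ?_⟩
    · rw [weight_smul, inv_mul_cancel₀ (hpos i).ne']
    · simp only [weight_smul, prod_mul_distrib, prod_inv_distrib]
      rw [inv_mul_le_one₀ hprod]
      exact hmax o'
  obtain ⟨o', h1, h2⟩ := hopt.exists_good hα0 hα1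
  refine ⟨o', fun i j => ?_, fun o'' => (hmax o'').trans ?_⟩
  · have := (h2 i j).smul (hpos i).le
    simpa only [weight_smul, mul_inv_cancel_left₀ (hpos i).ne'] using this
  · rw [Fintype.card, ← prod_const, ← prod_mul_distrib]
    refine prod_le_prod (fun i _ => (hpos i).le) fun i _ => ?_
    have := h1 i
    rw [weight_smul] at this
    have := mul_le_mul_of_nonneg_left this (hpos i).le
    calc weight (a i) (owned o i) = weight (a i) (owned o i) * 1 := (mul_one _).symm
      _ ≤ _ := this
      _ = _ := by field_simp [(hpos i).ne']

/-- Some agent is always left empty-handed, so every product vanishes, and any allocation with at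
most one item per agent will do. -/
theorem exists_solution_of_card_lt (hα0 : 0 ≤ α) (ha : ∀ i g, 0 ≤ a i g)
    (hcard : Fintype.card κ < Fintype.card ι) : ∃ o : κ → ι, Solution α a o := by
  obtain ⟨e⟩ := Function.Embedding.nonempty_of_card_le hcard.le
  refine ⟨e, fun i j => good_of_card_le_one (weight_nonneg (ha i) _) ?_, fun o' => ?_⟩
  · refine card_le_one.2 fun x hx y hy => e.injective ?_
    rw [mem_owned.1 hx, mem_owned.1 hy]
  · obtain ⟨i, hi⟩ : ∃ i, ∀ g, o' g ≠ i := by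
      by_contra! hcon
      exact absurd (Fintype.card_le_of_surjective o' hcon) (not_le.2 hcard)
    have h0 : owned o' i = ∅ := by ext g; simp [hi]
    rw [prod_eq_zero (mem_univ i) (by simp [h0, weight])]
    exact mul_nonneg (by positivity) (prod_nonneg fun i _ => weight_nonneg (ha i) _)

lemma isClosed_good {b : ℝ → κ → ℝ} (hb : Continuous b) {w : ℝ → ℝ} (hw : Continuous w)
    (B : Finset κ) : IsClosed {t | Good α (b t) (w t) B} := by
  have hS : ∀ S, Continuous fun t => weight (b t) S := fun S =>
    continuous_finsetSum _ fun g _ => (continuous_apply g).comp hb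
  have hg : ∀ g, Continuous fun t => b t g := fun g => (continuous_apply g).comp hb
  have hex : ∀ p : κ → ℝ → Prop, (∀ g, IsClosed {t | p g t}) →
      IsClosed {t | ∃ g ∈ B, p g t} := by
    intro p hp
    have : {t | ∃ g ∈ B, p g t} = ⋃ g ∈ B, {t | p g t} := by ext; simp
    rw [this]
    exact isClosed_biUnion_finset fun g _ => hp g
  have heq : {t | Good α (b t) (w t) B} =
      {t | ∀ g ∈ B, α * weight (b t) (B \ {g}) ≤ w t} ∩
      ({t | B = ∅} ∪ {t | ∃ g ∈ B, weight (b t) (B \ {g}) ≤ w t}) ∩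
      ({t | B.card ≤ 1} ∪ {t | α * weight (b t) B ≤ (α ^ 2 + 1) * w t}) ∩
      ({t | weight (b t) B ≤ 2 * w t} ∪ {t | ∃ g ∈ B, weight (b t) (B \ {g}) ≤ w t ∧
        weight (b t) (B \ {g}) * b t g ≤ w t ^ 2}) := by
    ext t
    exact ⟨fun h => ⟨⟨⟨h.efx, h.ef1⟩, h.group⟩, h.pair⟩, fun h => ⟨h.1.1.1, h.1.1.2, h.1.2, h.2⟩⟩
  rw [heq]
  refine ((IsClosed.inter ?_ ?_).inter ?_).inter ?_
  · simp only [Set.ofPred_forall]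
    exact isClosed_iInter fun g => isClosed_iInter fun _ =>
      isClosed_le (continuous_const.mul (hS _)) hw
  · exact isClosed_const.union (hex _ fun g => isClosed_le (hS _) hw)
  · exact isClosed_const.union
      (isClosed_le (continuous_const.mul (hS _)) (continuous_const.mul hw))
  · refine (isClosed_le (hS _) (continuous_const.mul hw)).union (hex _ fun g => ?_)
    exact (isClosed_le (hS _) hw).and (isClosed_le ((hS _).mul (hg g)) (hw.pow 2))

/-- Add t > 0 to all item values. For each of the finitely many allocations the set of t for which
it is a solution is closed, so their union, which contains all t > 0, also contains 0. -/
theorem exists_solution [Nonempty ι] (hα0 : 0 ≤ α) (hα1 : α * (1 + α) ≤ 1)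
    (ha : ∀ i g, 0 ≤ a i g) : ∃ o : κ → ι, Solution α a o := by
  rcases lt_or_ge (Fintype.card κ) (Fintype.card ι) with hcard | hcard
  · exact exists_solution_of_card_lt hα0 ha hcard
  let b : ℝ → ι → κ → ℝ := fun t i g => a i g + t
  have hb : ∀ i, Continuous fun t => b t i := fun i => by fun_prop
  have hS : ∀ i S, Continuous fun t => weight (b t i) S := fun i S =>
    continuous_finsetSum _ fun g _ => (continuous_apply g).comp (hb i)
  have hclosed : IsClosed (⋃ o : κ → ι, {t | Solution α (b t) o}) := by
    refine isClosed_iUnion_of_finite fun o => ?_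
    have heq : {t | Solution α (b t) o} =
        {t | ∀ i j, Good α (b t i) (weight (b t i) (owned o i)) (owned o j)} ∩
        {t | ∀ o' : κ → ι, ∏ i, weight (b t i) (owned o' i) ≤
          (1 + α) ^ Fintype.card ι * ∏ i, weight (b t i) (owned o i)} := by
      ext t
      exact ⟨fun h => ⟨h.1, h.2⟩, fun h => ⟨h.1, h.2⟩⟩
    rw [heq]
    refine IsClosed.inter ?_ ?_
    · simp only [Set.ofPred_forall]
      exact isClosed_iInter fun i => isClosed_iInter fun j => isClosed_good (hb i) (hS i _) _
    · simp only [Set.ofPred_forall]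
      exact isClosed_iInter fun o' => isClosed_le (continuous_finsetProd _ fun i _ => hS i _)
        (continuous_const.mul (continuous_finsetProd _ fun i _ => hS i _))
  have hsub : Set.Ioi (0 : ℝ) ⊆ ⋃ o : κ → ι, {t | Solution α (b t) o} := by
    intro t ht
    rw [Set.mem_iUnion]
    exact exists_solution_of_pos hα0 hα1 (fun i g => add_pos_of_nonneg_of_pos (ha i g) ht) hcard
  have h0 : (0 : ℝ) ∈ ⋃ o : κ → ι, {t | Solution α (b t) o} :=
    closure_minimal hsub hclosed (by rw [closure_Ioi]; exact Set.self_mem_Ici)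
  obtain ⟨o, ho⟩ := Set.mem_iUnion.1 h0
  exact ⟨o, by simpa [b] using ho⟩

end Existence

/-! ### Maximin shares and Nash welfare -/

section Shares

variable {n m : ℕ}

lemma IsAdditive.eq_weight {v : Finset (Fin m) → ℝ} (h : IsAdditive v) (S : Finset (Fin m)) :
    v S = weight (fun g => v {g}) S := by
  induction S using Finset.induction_on with
  | empty => simpa [weight] using h ∅ ∅ (disjoint_empty_left _)
  | insert g S hg ih =>
    rw [insert_eq, h _ _ (disjoint_singleton_left.2 hg), ih,
      weight_union (disjoint_singleton_left.2 hg)]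
    simp [weight]

lemma mul_maximinShare_le {v : Finset (Fin m) → ℝ} {k : ℕ} {S : Finset (Fin m)} {β c : ℝ}
    (hβ : 0 ≤ β) (hc : 0 ≤ c)
    (h : ∀ P : Fin k → Finset (Fin m), IsPartition S P → ∃ x, β * v (P x) ≤ c) :
    β * maximinShare v k S ≤ c := by
  rcases hβ.eq_or_lt with h0 | h0
  · rw [← h0]; simpa using hc
  rw [← le_div_iff₀' h0]
  -- The bound must be nonnegative because the supremum over no partitions is 0.
  refine Real.iSup_le (fun P => ?_) (by positivity)
  obtain ⟨x, hx⟩ := h P.1 P.2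
  exact (ciInf_le (Set.finite_range _).bddBelow x).trans ((le_div_iff₀' h0).2 hx)

lemma weight_biUnion {ι κ : Type*} [Fintype κ] [DecidableEq κ] (b : κ → ℝ) {I : Finset ι} {W : ι → Finset κ}
    (hW : ∀ i j, i ≠ j → Disjoint (W i) (W j)) :
    weight b (I.biUnion W) = ∑ j ∈ I, weight b (W j) :=
  sum_biUnion fun i _ j _ hij => hW i j hij

/-- If every bundle of a group is a single item or has value at most `c`, then every partition into
as many parts as there are bundles has a part of value at most `c`. -/
lemma exists_part_le {ι κ : Type*} [DecidableEq ι] [Fintype κ] [DecidableEq κ]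
    {b : κ → ℝ}
    (hb : ∀ g, 0 ≤ b g) {c : ℝ} {W : ι → Finset κ} (hW : ∀ i j, i ≠ j → Disjoint (W i) (W j))
    {I : Finset ι} {i : ι} (hi : i ∈ I) (hic : weight b (W i) ≤ c)
    (h : ∀ j ∈ I, (W j).card ≤ 1 ∨ weight b (W j) ≤ c) {P : Fin I.card → Finset κ}
    (hP : ∀ x y, x ≠ y → Disjoint (P x) (P y)) (hPI : univ.biUnion P = I.biUnion W) :
    ∃ x, weight b (P x) ≤ c := by
  classical
  have hc : 0 ≤ c := (weight_nonneg hb _).trans hic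
  -- The bundles in `J` are single items, so at most |J| parts meet them. The other parts, at least
  -- |I| - |J| in number, share bundles of value at most c; one of these parts is at most average.
  let J := I.filter fun j => c < weight b (W j)
  let K : Finset (Fin I.card) := univ.filter fun x => (P x ∩ J.biUnion W).Nonempty
  have hJI : J ⊆ I := filter_subset _ _
  have hKJ : K.card ≤ J.card := by
    have h1 : K.card ≤ (J.biUnion W).card := by
      refine (card_le_card_biUnion (f := fun x => P x ∩ J.biUnion W) (fun x _ y _ hxy => ?_)
        fun x hx => (mem_filter.1 hx).2).trans (card_le_card ?_)
      · exact (hP x y hxy).mono inter_subset_left inter_subset_left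
      · exact biUnion_subset.2 fun x _ => inter_subset_right
    refine h1.trans ((card_biUnion_le_card_mul J W 1 fun j hj => ?_).trans (mul_one _).le)
    obtain ⟨hjI, hj⟩ := mem_filter.1 hj
    exact (h j hjI).resolve_right (not_le.2 hj)
  have hiJ : i ∈ I \ J := by simp [J, hi, hic]
  have hcards : (I \ J).card ≤ Kᶜ.card := by
    rw [card_sdiff_of_subset hJI, card_compl, Fintype.card_fin]
    omega
  have hsub : Kᶜ.biUnion P ⊆ (I \ J).biUnion W := by
    intro g hg
    obtain ⟨x, hx, hgx⟩ := mem_biUnion.1 hg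
    have hgI : g ∈ I.biUnion W := hPI ▸ mem_biUnion.2 ⟨x, mem_univ _, hgx⟩
    obtain ⟨j, hj, hgj⟩ := mem_biUnion.1 hgI
    refine mem_biUnion.2 ⟨j, mem_sdiff.2 ⟨hj, fun hjJ => mem_compl.1 hx ?_⟩, hgj⟩
    exact mem_filter.2 ⟨mem_univ _, g, mem_inter.2 ⟨hgx, mem_biUnion.2 ⟨j, hjJ, hgj⟩⟩⟩
  have hsum : ∑ x ∈ Kᶜ, weight b (P x) ≤ ∑ _x ∈ Kᶜ, c := by
    calc ∑ x ∈ Kᶜ, weight b (P x) = weight b (Kᶜ.biUnion P) := (weight_biUnion b hP).symm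
      _ ≤ weight b ((I \ J).biUnion W) := weight_mono hb hsub
      _ = ∑ j ∈ I \ J, weight b (W j) := weight_biUnion b hW
      _ ≤ ∑ _j ∈ I \ J, c := sum_le_sum fun j hj => by
        by_contra! hlt
        exact (mem_sdiff.1 hj).2 (mem_filter.2 ⟨(mem_sdiff.1 hj).1, hlt⟩)
      _ ≤ ∑ _x ∈ Kᶜ, c := by
        rw [sum_const, sum_const, nsmul_eq_mul, nsmul_eq_mul]
        gcongr
  have hne : Kᶜ.Nonempty := card_pos.1 (lt_of_lt_of_le (card_pos.2 ⟨i, hiJ⟩) hcards)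
  obtain ⟨x, -, hx⟩ := exists_le_of_sum_le hne hsum
  exact ⟨x, hx⟩

/-- Let w be the value of A. If B is worth at most 2w, some part is worth at most 3w/2, and β ≤ 2/3.
Otherwise let x be the value of g and r that of the rest of B. If both parts exceeded w/β = (1+β)w,
the part without g would give r > βw and the total x > (1+2β)w - r. Then rx > w², since r((1+2β)w -
r) - w² = (r - βw)((1+β)w - r) ≥ 0. -/
lemma exists_half_le {κ : Type*} [Fintype κ] [DecidableEq κ] {b : κ → ℝ} (hb : ∀ g, 0 ≤ b g) {α β : ℝ}
    (hβ0 : 0 ≤ β) (hβ : β * (1 + β) = 1) {A B : Finset κ} (hAB : Disjoint A B)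
    (h : Good α b (weight b A) B) {P : Fin 2 → Finset κ}
    (hP : ∀ x y, x ≠ y → Disjoint (P x) (P y)) (hPI : univ.biUnion P = A ∪ B) :
    ∃ x, β * weight b (P x) ≤ weight b A := by
  have hw : 0 ≤ weight b A := weight_nonneg hb _
  have hsum : weight b (P 0) + weight b (P 1) = weight b A + weight b B := by
    rw [← weight_union hAB, ← hPI, weight_biUnion b hP, Fin.sum_univ_two]
  by_contra! hcon
  have h0 := hcon 0
  have h1 := hcon 1
  have hβ1 : β ≤ 2 / 3 := by nlinarith
  rcases h.pair with h2 | ⟨g, hg, h2, h3⟩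
  · have := mul_le_mul_of_nonneg_left h2 hβ0
    have : β * (weight b (P 0) + weight b (P 1)) = β * (weight b A + weight b B) := by rw [hsum]
    nlinarith
  · have hgB := weight_sdiff_singleton (b := b) hg
    have hr0 : 0 ≤ weight b (B \ {g}) := weight_nonneg hb _
    obtain ⟨y, hy⟩ : ∃ y, g ∉ P y := by
      by_contra! hall
      exact disjoint_left.1 (hP 0 1 (by decide)) (hall 0) (hall 1)
    have hPy : weight b (P y) ≤ weight b A + weight b (B \ {g}) := by
      rw [← weight_union (hAB.mono_right sdiff_subset)]
      refine weight_mono hb fun x hx => ?_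
      have hx' : x ∈ A ∪ B := hPI ▸ mem_biUnion.2 ⟨y, mem_univ _, hx⟩
      rcases mem_union.1 hx' with hxA | hxB
      · exact mem_union_left _ hxA
      · refine mem_union_right _ (mem_sdiff.2 ⟨hxB, fun hxg => hy ?_⟩)
        rwa [← mem_singleton.1 hxg]
    have hcy := hcon y
    have hBw : weight b B = b g + weight b (B \ {g}) := by linarith
    set w := weight b A
    set r := weight b (B \ {g})
    have hr : β * w < r := by
      have : w < β * (w + r) := hcy.trans_le (by gcongr)
      have hβpos : 0 < β := by
        rcases hβ0.eq_or_lt with h | h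
        · rw [← h] at hβ; simp at hβ
        · exact h
      refine lt_of_mul_lt_mul_left ?_ hβ0
      nlinarith
    have h4 : 2 * w < β * (w + b g + r) := by
      rw [hBw] at hsum
      have : β * (weight b (P 0) + weight b (P 1)) = β * (w + (b g + r)) := by rw [hsum]
      nlinarith
    have hrpos : 0 < r := by nlinarith [mul_nonneg hβ0 hw]
    have h5 : (2 * (1 + β)) * w < w + b g + r := by
      have := mul_lt_mul_of_pos_left h4 (show 0 < 1 + β by linarith)
      nlinarith
    have h6 := mul_lt_mul_of_pos_right h5 hrpos
    nlinarith [mul_nonneg (sub_nonneg.2 hr.le) (show 0 ≤ (1 + β) * w - r by nlinarith [mul_nonneg hβ0 hw])]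

lemma nashWelfare_eq {v : Fin n → Finset (Fin m) → ℝ} (hv : ∀ i, IsValuation (v i))
    (X : Fin n → Finset (Fin m)) : nashWelfare v X = (∏ i, v i (X i)) ^ (1 / (n : ℝ)) :=
  Real.finsetProd_rpow _ _ (fun i _ => hv i _) _

lemma exists_isMaxNashWelfare (v : Fin n → Finset (Fin m) → ℝ) :
    ∃ X, IsMaxNashWelfare v X := by
  classical
  obtain ⟨X, hX, hmax⟩ := exists_max_image
    (univ.filter fun X : Fin n → Finset (Fin m) => IsAllocation X) (nashWelfare v)
    ⟨fun _ => ∅, mem_filter.2 ⟨mem_univ _, fun _ _ _ => disjoint_empty_left _⟩⟩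
  exact ⟨X, (mem_filter.1 hX).2, fun Y hY => hmax Y (mem_filter.2 ⟨mem_univ _, hY⟩)⟩

lemma IsAllocation.exists_subset_owned [Nonempty (Fin n)] {X : Fin n → Finset (Fin m)}
    (hX : IsAllocation X) : ∃ o : Fin m → Fin n, ∀ i, X i ⊆ owned o i := by
  classical
  have hex : ∀ g, ∃ i, ∀ j, g ∈ X j → i = j := by
    intro g
    by_cases hg : ∃ i, g ∈ X i
    · obtain ⟨i, hi⟩ := hg
      refine ⟨i, fun j hj => ?_⟩
      by_contra hij
      exact disjoint_left.1 (hX i j hij) hi hj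
    · push Not at hg
      exact ⟨Classical.arbitrary _, fun j hj => absurd hj (hg j)⟩
  choose o ho using hex
  exact ⟨o, fun i g hg => mem_owned.2 (ho g i hg)⟩

end Shares

end FairDivision

/-! ### The five guarantees together -/

theorem mainTheorem6 (n m : ℕ) (hn : 0 < n) (v : Fin n → Finset (Fin m) → ℝ)
    (hv : ∀ i, FairDivision.IsValuation (v i)) (hadd : ∀ i, FairDivision.IsAdditive (v i))
    (α : ℝ) (hα0 : 0 ≤ α) (hα1 : α ≤ Real.goldenRatio - 1) :
    ∃ X : Fin n → Finset (Fin m),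
      FairDivision.IsCompleteAllocation X ∧
      FairDivision.IsEFX v α X ∧
      FairDivision.IsEF1 v X ∧
      FairDivision.IsGMMS v (α / (α ^ 2 + 1)) X ∧
      FairDivision.IsPMMS v (Real.goldenRatio - 1) X ∧
      FairDivision.IsMNW v (1 / (α + 1)) X := by
  open FairDivision in
  have : Nonempty (Fin n) := ⟨⟨0, hn⟩⟩
  have hφ := Real.goldenRatio_sq
  have hφ1 := Real.one_lt_goldenRatio
  -- Equality holds at φ - 1, as (φ - 1)φ = 1.
  have hα : α * (1 + α) ≤ 1 := by nlinarith
  let a : Fin n → Fin m → ℝ := fun i g => v i {g}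
  have ha : ∀ i g, 0 ≤ a i g := fun i g => hv i _
  have hva : ∀ i S, v i S = weight (a i) S := fun i S => (hadd i).eq_weight S
  obtain ⟨o, hgood, hprod⟩ := exists_solution hα0 hα ha
  have hdisj : IsAllocation (owned o) := by
    intro i j hij
    rw [disjoint_left]
    intro g hi hj
    exact hij ((mem_owned.1 hi).symm.trans (mem_owned.1 hj))
  refine ⟨owned o, ⟨hdisj, ?_⟩, fun i j g hg => ?_, fun i j => ?_, fun I i hi => ?_,
    fun i j hij => ?_, ?_⟩
  · ext g; simp
  · rw [hva, hva]; exact (hgood i j).efx g hg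
  · simp only [hva]; exact (hgood i j).ef1
  · refine mul_maximinShare_le (by positivity) (hv i _) fun P hP => ?_
    simp only [hva]
    have hw := weight_nonneg (ha i) (owned o i)
    -- The threshold used below divides by α.
    rcases hα0.eq_or_lt with h0 | h0
    · exact ⟨⟨0, card_pos.2 ⟨i, hi⟩⟩, by simpa [← h0] using hw⟩
    have hpos : 0 < α / (α ^ 2 + 1) := by positivity
    have hle : ∀ S, α / (α ^ 2 + 1) * weight (a i) S ≤ weight (a i) (owned o i) ↔
        α * weight (a i) S ≤ (α ^ 2 + 1) * weight (a i) (owned o i) := by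
      intro S
      rw [div_mul_eq_mul_div, div_le_iff₀ (by positivity), mul_comm (weight (a i) (owned o i))]
    obtain ⟨x, hx⟩ := exists_part_le (ha i)
      (c := weight (a i) (owned o i) / (α / (α ^ 2 + 1))) hdisj hi
      ((le_div_iff₀' hpos).2 ((hle _).2 (by nlinarith)))
      (fun j _ => (hgood i j).group.imp id fun h => (le_div_iff₀' hpos).2 ((hle _).2 h))
      hP.1 hP.2
    exact ⟨x, (le_div_iff₀' hpos).1 hx⟩
  · refine mul_maximinShare_le (by linarith) (hv i _) fun P hP => ?_
    simp only [hva]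
    exact exists_half_le (ha i) (by linarith) (by nlinarith) (hdisj i j hij) (hgood i j) hP.1 hP.2
  · obtain ⟨X, hX⟩ := exists_isMaxNashWelfare v
    refine ⟨X, hX, ?_⟩
    -- A partial optimum is completed arbitrarily, which lowers no value.
    obtain ⟨o', ho'⟩ := hX.1.exists_subset_owned
    have h0 : 0 ≤ ∏ i, v i (X i) := prod_nonneg fun i _ => hv i _
    have h0' : 0 ≤ ∏ i, v i (owned o i) := prod_nonneg fun i _ => hv i _
    have h1 : ∏ i, v i (X i) ≤ (1 + α) ^ n * ∏ i, v i (owned o i) := by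
      simp only [hva]
      refine le_trans (prod_le_prod (fun i _ => weight_nonneg (ha i) _)
        fun i _ => weight_mono (ha i) (ho' i)) ?_
      simpa using hprod o'
    rw [nashWelfare_eq hv, nashWelfare_eq hv, one_div_mul_eq_div,
      div_le_iff₀ (by positivity)]
    calc (∏ i, v i (X i)) ^ (1 / (n : ℝ))
        ≤ ((1 + α) ^ n * ∏ i, v i (owned o i)) ^ (1 / (n : ℝ)) :=
          Real.rpow_le_rpow h0 h1 (by positivity)
      _ = (∏ i, v i (owned o i)) ^ (1 / (n : ℝ)) * (α + 1) := by
        rw [Real.mul_rpow (by positivity) h0', one_div,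
          Real.pow_rpow_inv_natCast (by positivity) hn.ne', mul_comm, add_comm 1 α]
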